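/- **Theorem 6.2.** Let $G=\{z\in\mathbb C:\operatorname{Im}z>0\}$. For a function $v:G\to(0,\infty)$ let $H_v(G)$ be the space of all holomorphic $f:G\to\mathbb C$ with $\|f\|_v:=\sup_{z\in G}v(z)|f(z)|<\infty$, and let $H_{v_0}(G)$ be the subspace of those $f\in H_v(G)$ such that for every $\varepsilon>0$ there is a compact set $K\subset G$ with $\sup_{z\in G\setminus K}v(z)|f(z)|<\varepsilon$. Let $\varphi:(0,\infty)\to\mathbb R$ satisfy 1. $\sup_{1/c\le y\le c}\varphi(y)<\infty$ for every $c>1$; 2. there is $a\in\mathbb R$ with $\inf_{x>0}(\varphi(x)-ax)>-\infty$; 3. $\lim_{x\to0^+}\varphi(x)=+\infty$. Let $$\varphi^{**}(x)=\sup\Bigl\{ax+b:\ a,b\in\mathbb R,\ \inf_{t>0}(\varphi(t)-at)>b\Bigr\},\qquad x>0,$$ and put $v(z)=e^{-\varphi(\operatorname{Im}z)}$ and $w(z)=e^{-\varphi^{**}(\operatorname{Im}z)}$ for $z\in G$. Then $H_{v_0}(G)=H_{w_0}(G)$ as spaces of functions, and $\|f\|_v=\|f\|_w$ for every $f$ in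 this space. -/

import Mathlib

open Set Filter Topology UpperHalfPlane
open scoped Manifold

noncomputable section

namespace WeightedHalfPlane

/-- The class `Φ` of functions `φ : (0, ∞) → ℝ` such that `φ x - a x` is bounded below on `(0, ∞)`
for some real `a`. A function on `(0, ∞)` is represented by a function `ℝ → ℝ`, of which only the
values on `(0, ∞)` are ever used. -/
def MemPhi (φ : ℝ → ℝ) : Prop :=
  ∃ a : ℝ, BddBelow ((fun x => φ x - a * x) '' Ioi 0)

/-- The set `M_φ` of the pairs `(a, b)` with `inf_{t > 0} (φ t - a t) > b`. The infimum is taken in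
`[-∞, ∞)`, so the inequality includes that it is not `-∞`. -/
def affineMinorants (φ : ℝ → ℝ) : Set (ℝ × ℝ) :=
  {p | BddBelow ((fun t => φ t - p.1 * t) '' Ioi 0) ∧
    p.2 < sInf ((fun t => φ t - p.1 * t) '' Ioi 0)}

/-- The second Young-Fenchel conjugate `φ** x = sup_{(a, b) ∈ M_φ} (a x + b)`, for `x > 0`. -/
def biconj (φ : ℝ → ℝ) (x : ℝ) : ℝ :=
  sSup ((fun p : ℝ × ℝ => p.1 * x + p.2) '' affineMinorants φ)

/-- `φ` is bounded above on `[1/c, c]` for every `c > 1`. -/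
def LocallyBddAbove (φ : ℝ → ℝ) : Prop :=
  ∀ c : ℝ, 1 < c → BddAbove (φ '' Icc (1 / c) c)

/-- The weight `z ↦ exp (-φ (Im z))` on the upper half plane. -/
def expWeight (φ : ℝ → ℝ) (z : ℍ) : Ioi (0 : ℝ) :=
  ⟨Real.exp (-φ z.im), Real.exp_pos _⟩

/-- `‖f‖_v = sup_{z ∈ G} v z |f z|`, used only where this supremum is finite. -/
def weightedNorm (v : ℍ → Ioi (0 : ℝ)) (f : ℍ → ℂ) : ℝ :=
  ⨆ z : ℍ, (v z : ℝ) * ‖f z‖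

theorem weighted_add_le (v : ℍ → Ioi (0 : ℝ)) (f g : ℍ → ℂ) (z : ℍ) :
    (v z : ℝ) * ‖(f + g) z‖ ≤ (v z : ℝ) * ‖f z‖ + (v z : ℝ) * ‖g z‖ := by
  rw [← mul_add]
  exact mul_le_mul_of_nonneg_left (norm_add_le _ _) (le_of_lt (v z).2)

theorem weighted_smul (v : ℍ → Ioi (0 : ℝ)) (c : ℂ) (f : ℍ → ℂ) (z : ℍ) :
    (v z : ℝ) * ‖(c • f) z‖ = ‖c‖ * ((v z : ℝ) * ‖f z‖) := by
  simp only [Pi.smul_apply, norm_smul]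
  ring

/-- The space `H_v(G)` of the holomorphic functions `f` on the upper half plane with
`sup_z v z |f z| < ∞`. -/
def H (v : ℍ → Ioi (0 : ℝ)) : Submodule ℂ (ℍ → ℂ) where
  carrier := {f | MDifferentiable 𝓘(ℂ) 𝓘(ℂ) f ∧ BddAbove (range fun z => (v z : ℝ) * ‖f z‖)}
  zero_mem' := ⟨mdifferentiable_const (c := (0 : ℂ)), ⟨0, by rintro _ ⟨z, rfl⟩; simp⟩⟩
  add_mem' := by
    rintro f g ⟨hf, A, hA⟩ ⟨hg, B, hB⟩
    refine ⟨hf.add hg, A + B, ?_⟩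
    rintro _ ⟨z, rfl⟩
    exact (weighted_add_le v f g z).trans (add_le_add (hA ⟨z, rfl⟩) (hB ⟨z, rfl⟩))
  smul_mem' := by
    rintro c f ⟨hf, A, hA⟩
    refine ⟨hf.const_smul c, ‖c‖ * A, ?_⟩
    rintro _ ⟨z, rfl⟩
    exact (weighted_smul v c f z).trans_le
      (mul_le_mul_of_nonneg_left (hA ⟨z, rfl⟩) (norm_nonneg c))

/-- The space `H_{v0}(G)` of the `f ∈ H_v(G)` such that, for every `ε > 0`, there is a compact
`K ⊆ G` with `v |f| < ε` off `K`. (Since `ε` is arbitrary, this is the same as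
`sup_{G \ K} v |f| < ε`.) -/
def H0 (v : ℍ → Ioi (0 : ℝ)) : Submodule ℂ (ℍ → ℂ) where
  carrier := {f | f ∈ H v ∧
    ∀ ε : ℝ, 0 < ε → ∃ K : Set ℍ, IsCompact K ∧ ∀ z ∉ K, (v z : ℝ) * ‖f z‖ < ε}
  zero_mem' := ⟨zero_mem _, fun ε hε => ⟨∅, isCompact_empty, fun z _ => by simpa using hε⟩⟩
  add_mem' := by
    rintro f g ⟨hf, hf0⟩ ⟨hg, hg0⟩
    refine ⟨add_mem hf hg, fun ε hε => ?_⟩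
    obtain ⟨K, hK, h1⟩ := hf0 (ε / 2) (half_pos hε)
    obtain ⟨L, hL, h2⟩ := hg0 (ε / 2) (half_pos hε)
    refine ⟨K ∪ L, hK.union hL, fun z hz => ?_⟩
    have hz1 := h1 z fun h => hz (Or.inl h)
    have hz2 := h2 z fun h => hz (Or.inr h)
    have := weighted_add_le v f g z
    linarith
  smul_mem' := by
    rintro c f ⟨hf, hf0⟩
    refine ⟨Submodule.smul_mem _ c hf, fun ε hε => ?_⟩
    have hc : 0 < ‖c‖ + 1 := by positivity
    obtain ⟨K, hK, h1⟩ := hf0 (ε / (‖c‖ + 1)) (div_pos hε hc)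
    refine ⟨K, hK, fun z hz => ?_⟩
    have h2 := (lt_div_iff₀ hc).1 (h1 z hz)
    have h3 : 0 ≤ (v z : ℝ) * ‖f z‖ := mul_nonneg (le_of_lt (v z).2) (norm_nonneg _)
    rw [weighted_smul]
    nlinarith

end WeightedHalfPlane

end

open Set Filter Topology UpperHalfPlane
open scoped Manifold

namespace WeightedHalfPlane

/-! For nonzero `f ∈ H0 v`, let g(y) be the logarithm of sup |f| on the line Im z = y. By the three
lines theorem g is convex, and ‖f‖_v ≤ C says that g - log C ≤ φ. The support lines of g - log C are
then affine minorants of φ, so g - log C ≤ φ**. With φ** ≤ φ this gives equality of norms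
(`norm_le_mul_exp_biconj`).

For the vanishing condition, φ - g → ∞ at 0 and at ∞ must pass to φ** - g. A support line of g
touching near the given end, raised by N, has to stay below φ; the gap φ - g gives room near that
end, so the line must be low elsewhere. At 0 either the slopes tend to -∞, which suffices, or g is
bounded above and φ** → ∞ decides (`tendsto_biconj_sub_zero`). At ∞ the argument fails only if g is
asymptotic to an affine function (`tendsto_biconj_sub_atTop`). This is excluded because f vanishes
at infinity on the line Im z = 1 (`exists_log_lineSup_lt`). -/

/-! ### Affine minorants and the biconjugate -/

theorem affine_le_of_mem_affineMinorants {φ : ℝ → ℝ} {x : ℝ} (hx : 0 < x) {p : ℝ × ℝ}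
    (hp : p ∈ affineMinorants φ) : p.1 * x + p.2 ≤ φ x := by
  have h := hp.2.le.trans (csInf_le hp.1 ⟨x, hx, rfl⟩)
  simp only at h
  linarith

theorem mem_affineMinorants {φ : ℝ → ℝ} {a b c : ℝ} (h : ∀ t, 0 < t → a * t + b ≤ φ t)
    (hc : c < b) : (a, c) ∈ affineMinorants φ := by
  have hb : b ∈ lowerBounds ((fun t => φ t - a * t) '' Ioi 0) := by
    rintro _ ⟨t, ht, rfl⟩
    have := h t ht
    simp only
    linarith
  exact ⟨⟨b, hb⟩, hc.trans_le (le_csInf (nonempty_Ioi.image _) hb)⟩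

theorem MemPhi.exists_affine_le {φ : ℝ → ℝ} (hφ : MemPhi φ) :
    ∃ a b : ℝ, ∀ t, 0 < t → a * t + b ≤ φ t := by
  obtain ⟨a, b, hb⟩ := hφ
  refine ⟨a, b, fun t ht => ?_⟩
  have := hb ⟨t, ht, rfl⟩
  simp only at this
  linarith

theorem biconj_le {φ : ℝ → ℝ} (hφ : MemPhi φ) {x : ℝ} (hx : 0 < x) : biconj φ x ≤ φ x := by
  obtain ⟨a, b, h⟩ := hφ.exists_affine_le
  refine csSup_le ⟨_, _, mem_affineMinorants h (sub_one_lt b), rfl⟩ ?_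
  rintro _ ⟨p, hp, rfl⟩
  exact affine_le_of_mem_affineMinorants hx hp

theorem le_biconj {φ : ℝ → ℝ} {a b x : ℝ} (h : ∀ t, 0 < t → a * t + b ≤ φ t) (hx : 0 < x) :
    a * x + b ≤ biconj φ x := by
  -- The inequality defining M_φ is strict, so b is first lowered by ε.
  refine le_of_forall_pos_sub_le fun ε hε => ?_
  refine le_csSup ⟨φ x, ?_⟩ ⟨_, mem_affineMinorants h (sub_lt_self b hε), ?_⟩
  · rintro _ ⟨p, hp, rfl⟩
    exact affine_le_of_mem_affineMinorants hx hp
  · simp only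
    ring

theorem MemPhi.exists_lower_bound {φ : ℝ → ℝ} (hφ : MemPhi φ) (R : ℝ) :
    ∃ m, ∀ t, 0 < t → t ≤ R → m ≤ φ t := by
  obtain ⟨a, b, h⟩ := hφ.exists_affine_le
  refine ⟨b - |a| * R, fun t ht htR => ?_⟩
  have h1 := h t ht
  nlinarith [neg_abs_le a, abs_nonneg a]

theorem tendsto_biconj_zero {φ : ℝ → ℝ} (hφ : MemPhi φ) (h0 : Tendsto φ (𝓝[>] 0) atTop) :
    Tendsto (biconj φ) (𝓝[>] 0) atTop := by
  obtain ⟨a, b, h⟩ := hφ.exists_affine_le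
  rw [tendsto_atTop]
  intro N
  obtain ⟨δ, hδ, hN⟩ := mem_nhdsGT_iff_exists_Ioo_subset.1 ((tendsto_atTop.1 h0) (N + 1))
  have hδ : 0 < δ := hδ
  -- With this k the line -k t + (N + 1) lies below N + 1 on (0, δ) and below a t + b from δ on.
  obtain ⟨k, hk⟩ : ∃ k, k = max (|a|) ((N + 1 - b) / δ - a) := ⟨_, rfl⟩
  have hk0 : 0 ≤ k := hk ▸ (abs_nonneg a).trans (le_max_left _ _)
  have hka : 0 ≤ k + a := by
    have : |a| ≤ k := hk ▸ le_max_left _ _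
    linarith [neg_abs_le a]
  have hkδ : N + 1 - b ≤ (k + a) * δ := by
    have : (N + 1 - b) / δ - a ≤ k := hk ▸ le_max_right _ _
    rw [← div_le_iff₀ hδ]
    linarith
  have hmin : ∀ t, 0 < t → -k * t + (N + 1) ≤ φ t := by
    intro t ht
    rcases lt_or_ge t δ with htδ | htδ
    · have : N + 1 ≤ φ t := hN ⟨ht, htδ⟩
      nlinarith
    · have := h t ht
      nlinarith
  have hpos : 0 < 1 / (k + 1) := by positivity
  filter_upwards [Ioo_mem_nhdsGT hpos] with x hx
  have h1 := le_biconj hmin hx.1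
  have h2 : x * (k + 1) < 1 := (lt_div_iff₀ (by positivity)).1 hx.2
  nlinarith [hx.1]

/-! ### Transferring divergence of φ - g to φ** - g -/

section SupportLines

variable {g s φ : ℝ → ℝ}

theorem support_mono (hs : ∀ x, 0 < x → ∀ y, 0 < y → g x + s x * (y - x) ≤ g y) {x y : ℝ}
    (hx : 0 < x) (hxy : x ≤ y) : s x ≤ s y := by
  rcases hxy.eq_or_lt with rfl | hlt
  · exact le_rfl
  · have h1 := hs x hx y (hx.trans hlt)
    have h2 := hs y (hx.trans hlt) x hx
    by_contra! h
    nlinarith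

theorem le_biconj_of_support (hs : ∀ x, 0 < x → ∀ y, 0 < y → g x + s x * (y - x) ≤ g y)
    (h : ∀ t, 0 < t → g t ≤ φ t) {x : ℝ} (hx : 0 < x) : g x ≤ biconj φ x := by
  have := le_biconj (φ := φ) (a := s x) (b := g x - s x * x) (x := x) (fun t ht => ?_) hx
  · linarith
  · have h1 := hs x hx t ht
    have h2 := h t ht
    linarith

theorem tendsto_biconj_sub_zero (hφ : MemPhi φ) (h0 : Tendsto φ (𝓝[>] 0) atTop)
    (hs : ∀ x, 0 < x → ∀ y, 0 < y → g x + s x * (y - x) ≤ g y)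
    (h : Tendsto (fun x => φ x - g x) (𝓝[>] 0) atTop) :
    Tendsto (fun x => biconj φ x - g x) (𝓝[>] 0) atTop := by
  by_cases hbd : ∃ k, ∀ x, 0 < x → -k ≤ s x
  · obtain ⟨k, hk⟩ := hbd
    have hb : ∀ᶠ x in 𝓝[>] (0 : ℝ), -(g 1 + |k|) ≤ -g x := by
      filter_upwards [Ioo_mem_nhdsGT one_pos] with x hx
      have h1 := hs x hx.1 1 one_pos
      have h2 := hk x hx.1
      nlinarith [le_abs_self k, abs_nonneg k, hx.1, hx.2]
    simpa only [sub_eq_add_neg] using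
      tendsto_atTop_add_right_of_le' _ _ (tendsto_biconj_zero hφ h0) hb
  · push Not at hbd
    rw [tendsto_atTop]
    intro N
    obtain ⟨δ, hδ, hN⟩ := mem_nhdsGT_iff_exists_Ioo_subset.1 ((tendsto_atTop.1 h) N)
    have hδ : 0 < δ := hδ
    obtain ⟨a, b, hab⟩ := hφ.exists_affine_le
    -- The second bound puts the support line raised by N below a t + b at t = δ, using its value at
    -- δ / 2; the first makes it decrease faster afterwards.
    obtain ⟨x₀, hx₀, hsx₀⟩ := hbd (max (|a|) (2 * (g (δ / 2) + N - a * δ - b) / δ))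
    have hs1 := (le_max_left _ _).trans_lt (lt_neg_of_lt_neg hsx₀)
    have hs2 := (le_max_right _ _).trans_lt (lt_neg_of_lt_neg hsx₀)
    rw [div_lt_iff₀ hδ] at hs2
    filter_upwards [Ioo_mem_nhdsGT hx₀] with x hx
    have hsx := support_mono hs hx.1 hx.2.le
    have := le_biconj (φ := φ) (a := s x) (b := g x - s x * x + N) (x := x) (fun t ht => ?_) hx.1
    · linarith
    · rcases lt_or_ge t δ with htδ | htδ
      · have h1 := hs x hx.1 t ht
        have h2 : N ≤ φ t - g t := hN ⟨ht, htδ⟩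
        linarith
      · have h1 := hs x hx.1 (δ / 2) (by positivity)
        have h2 := hab t ht
        have h3 : 0 ≤ (a - s x) * (t - δ) :=
          mul_nonneg (by linarith [neg_abs_le a]) (by linarith)
        nlinarith

/-- If the slopes are bounded with supremum a, the intercepts decrease, and they tend to -∞ because
g(y) - a y is unbounded below. If the slopes are unbounded, a steep line below g(2R) at 2R is very
low on (0, R]. -/
theorem exists_support_le_neg (hs : ∀ x, 0 < x → ∀ y, 0 < y → g x + s x * (y - x) ≤ g y)
    (hg : ∀ a C : ℝ, (∀ y, 1 ≤ y → g y ≤ a * y + C) → ∀ B, ∃ y, 1 ≤ y ∧ g y < a * y + B)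
    {R : ℝ} (hR : 0 < R) (K : ℝ) :
    ∃ x₀, 0 < x₀ ∧ ∀ x, x₀ ≤ x → ∀ t, 0 < t → t ≤ R → g x + s x * (t - x) ≤ -K := by
  by_cases hbd : BddAbove (s '' Ioi 0)
  · obtain ⟨a, ha⟩ : ∃ a, a = sSup (s '' Ioi 0) := ⟨_, rfl⟩
    have hsa : ∀ x, 0 < x → s x ≤ a := fun x hx => ha ▸ le_csSup hbd ⟨x, hx, rfl⟩
    have hlt : ∀ B, ∃ y, 1 ≤ y ∧ g y < a * y + B := by
      refine hg a (g 1 - a) fun y hy => ?_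
      have h1 := hs y (by linarith) 1 one_pos
      have h2 := hsa y (by linarith)
      nlinarith
    obtain ⟨x₀, hx₀, hc⟩ : ∃ x₀, 0 < x₀ ∧ g x₀ - s x₀ * x₀ < -K - |a| * R := by
      by_contra! hcon
      obtain ⟨y, hy1, hy⟩ := hlt (-K - |a| * R - 1)
      have hy0 : 0 < y := by linarith
      obtain ⟨_, ⟨x, hx, rfl⟩, hx'⟩ := exists_lt_of_lt_csSup (nonempty_Ioi.image s)
        (ha ▸ sub_lt_self a (one_div_pos.2 hy0))
      rw [← ha] at hx'
      have h1 := hcon x hx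
      have h2 := hs x hx y hy0
      have h3 : (a - 1 / y) * y ≤ s x * y := mul_le_mul_of_nonneg_right hx'.le hy0.le
      have h4 : (a - 1 / y) * y = a * y - 1 := by field_simp
      nlinarith
    refine ⟨x₀, hx₀, fun x hx t ht htR => ?_⟩
    have hxp := hx₀.trans_le hx
    have h1 := hs x hxp x₀ hx₀
    have h2 : s x₀ * x₀ ≤ s x * x₀ := mul_le_mul_of_nonneg_right (support_mono hs hx₀ hx) hx₀.le
    have h3 : s x * t ≤ |a| * t :=
      mul_le_mul_of_nonneg_right ((hsa x hxp).trans (le_abs_self a)) ht.le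
    have h4 : |a| * t ≤ |a| * R := mul_le_mul_of_nonneg_left htR (abs_nonneg a)
    nlinarith
  · rw [not_bddAbove_iff] at hbd
    obtain ⟨_, ⟨x₀, hx₀, rfl⟩, hS⟩ := hbd (max 0 ((g (2 * R) + K) / R))
    refine ⟨x₀, hx₀, fun x hx t ht htR => ?_⟩
    have hsx := support_mono hs hx₀ hx
    have h1 := (le_max_left _ _).trans_lt hS
    have h2 := (le_max_right _ _).trans_lt hS
    rw [div_lt_iff₀ hR] at h2
    have h3 := hs x (lt_of_lt_of_le hx₀ hx) (2 * R) (by positivity)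
    have h4 : s x₀ * R ≤ s x * R := mul_le_mul_of_nonneg_right hsx hR.le
    have h5 : s x * R ≤ s x * (2 * R - t) :=
      mul_le_mul_of_nonneg_left (by linarith) (by linarith)
    nlinarith

theorem tendsto_biconj_sub_atTop (hφ : MemPhi φ)
    (hs : ∀ x, 0 < x → ∀ y, 0 < y → g x + s x * (y - x) ≤ g y)
    (hg : ∀ a C : ℝ, (∀ y, 1 ≤ y → g y ≤ a * y + C) → ∀ B, ∃ y, 1 ≤ y ∧ g y < a * y + B)
    (h : Tendsto (fun x => φ x - g x) atTop atTop) :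
    Tendsto (fun x => biconj φ x - g x) atTop atTop := by
  rw [tendsto_atTop]
  intro N
  obtain ⟨R, hR, hN⟩ := ((tendsto_atTop.1 h N).and (eventually_gt_atTop 0)).exists_forall_of_atTop
    |>.imp fun R hR => And.intro (hR R le_rfl).2 fun t ht => (hR t ht).1
  obtain ⟨m, hm⟩ := hφ.exists_lower_bound R
  obtain ⟨x₀, hx₀, hK⟩ := exists_support_le_neg hs hg hR (N - m)
  filter_upwards [eventually_ge_atTop x₀] with x hx
  have hxp := hx₀.trans_le hx
  have := le_biconj (φ := φ) (a := s x) (b := g x - s x * x + N) (x := x) (fun t ht => ?_) hxp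
  · linarith
  · rcases le_total t R with htR | htR
    · have h1 := hK x hx t ht htR
      have h2 := hm t ht htR
      linarith
    · have h1 := hs x hxp t ht
      have h2 := hN t htR
      linarith

end SupportLines

/-! ### Bounded holomorphic functions on strips and half planes -/

theorem norm_le_interp_of_im {F : ℂ → ℂ} (hF : DifferentiableOn ℂ F {z | 0 < z.im})
    {l y u a b C : ℝ} (hl : 0 < l) (hly : l < y) (hyu : y < u)
    (hC : ∀ z : ℂ, l ≤ z.im → z.im ≤ u → ‖F z‖ ≤ C)
    (ha : ∀ x : ℝ, ‖F (x + l * Complex.I)‖ ≤ a) (hb : ∀ x : ℝ, ‖F (x + u * Complex.I)‖ ≤ b) (x : ℝ) :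
    ‖F (x + y * Complex.I)‖ ≤ a ^ (1 - (y - l) / (u - l)) * b ^ ((y - l) / (u - l)) := by
  have hlu := hly.trans hyu
  have hz : ((y : ℂ) - x * Complex.I) * Complex.I = x + y * Complex.I := by
    linear_combination (-(x : ℂ)) * Complex.I_mul_I
  have hline : ∀ (r : ℝ) (z : ℂ), z.re = r → z * Complex.I = ((-z.im : ℝ) : ℂ) + r * Complex.I := by
    rintro r z rfl
    apply Complex.ext <;> simp
  have key := Complex.HadamardThreeLines.norm_le_interp_of_mem_verticalClosedStrip'
    (f := fun z => F (z * Complex.I)) (z := (y : ℂ) - x * Complex.I) (a := a) (b := b) hlu ?_ ?_ ?_ ?_ ?_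
  · simpa [hz] using key
  · simp [Complex.HadamardThreeLines.verticalClosedStrip, hly.le, hyu.le]
  · refine DifferentiableOn.diffContOnCl fun z hz => ?_
    have hz' : z ∈ Complex.re ⁻¹' Icc l u :=
      closure_minimal (preimage_mono Ioo_subset_Icc_self)
        (isClosed_Icc.preimage Complex.continuous_re) hz
    have h0 : 0 < (z * Complex.I).im := by simpa using hl.trans_le hz'.1
    have hd : DifferentiableAt ℂ F (z * Complex.I) :=
      hF.differentiableAt ((isOpen_lt continuous_const Complex.continuous_im).mem_nhds h0)
    exact (hd.comp z (differentiableAt_id.mul_const Complex.I)).differentiableWithinAt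
  · refine ⟨C, ?_⟩
    rintro _ ⟨z, hz, rfl⟩
    exact hC _ (by simpa using hz.1) (by simpa using hz.2)
  · intro z hz
    simp only [hline l z hz]
    exact ha _
  · intro z hz
    simp only [hline u z hz]
    exact hb _

/-- Phragmén-Lindelöf: C is only an a priori bound, so the boundary bound A prevails. -/
theorem norm_le_of_norm_le_on_line {F : ℂ → ℂ} (hF : DifferentiableOn ℂ F {z | 0 < z.im}) {C A : ℝ}
    (hC : ∀ z : ℂ, 1 ≤ z.im → ‖F z‖ ≤ C) (hA : ∀ x : ℝ, ‖F (x + Complex.I)‖ ≤ A) {z : ℂ}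
    (hz : 1 ≤ z.im) : ‖F z‖ ≤ A := by
  have him : ∀ w : ℂ, (w * Complex.I + Complex.I).im = w.re + 1 := by simp
  have key := PhragmenLindelof.right_half_plane_of_bounded_on_real
    (f := fun w => F (w * Complex.I + Complex.I)) (C := A) (z := -(z - Complex.I) * Complex.I) ?_ ?_ ?_ ?_ ?_
  · have hzz : -(z - Complex.I) * Complex.I * Complex.I + Complex.I = z := by
      linear_combination (Complex.I - z) * Complex.I_mul_I
    simpa only [hzz] using key
  · refine DifferentiableOn.diffContOnCl fun w hw => ?_
    have hw' : 0 ≤ w.re := closure_minimal (t := {w : ℂ | 0 ≤ w.re}) (fun w (hw : 0 < w.re) => hw.le)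
        (isClosed_le continuous_const Complex.continuous_re) hw
    have h0 : 0 < (w * Complex.I + Complex.I).im := by rw [him]; linarith
    have hd : DifferentiableAt ℂ F (w * Complex.I + Complex.I) :=
      hF.differentiableAt ((isOpen_lt continuous_const Complex.continuous_im).mem_nhds h0)
    exact (DifferentiableAt.comp (f := fun w : ℂ => w * Complex.I + Complex.I) w hd
      (by fun_prop)).differentiableWithinAt
  · refine ⟨0, two_pos, 0, ?_⟩
    refine Asymptotics.IsBigO.of_bound C ?_
    filter_upwards [mem_inf_of_right (mem_principal_self _)] with w hw
    have hw : 0 < w.re := hw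
    simpa using hC _ (by rw [him]; linarith)
  · refine ⟨C, ?_⟩
    rw [eventually_map]
    filter_upwards [eventually_ge_atTop 0] with x hx
    exact hC _ (by rw [him]; simpa using hx)
  · intro x
    have : (x : ℂ) * Complex.I * Complex.I + Complex.I = ((-x : ℝ) : ℂ) + Complex.I := by
      push_cast
      linear_combination (x : ℂ) * Complex.I_mul_I
    simp only [this]
    exact hA _
  · simpa using hz

/-- Since D > 2T, at most one translate falls in [-T, T]; it costs C, every other one ε. -/
theorem norm_sum_translates_le {F : ℂ → ℂ} {C T ε : ℝ} (hC0 : 0 ≤ C)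
    (hC : ∀ x : ℝ, ‖F (x + Complex.I)‖ ≤ C) (hε : 0 ≤ ε) (hT : ∀ x : ℝ, T < |x| → ‖F (x + Complex.I)‖ ≤ ε)
    (n : ℕ) {D : ℝ} (hD0 : 0 < D) (hD : 2 * T < D) (x : ℝ) :
    ‖∑ k ∈ Finset.range n, F (x + Complex.I + (k : ℂ) * D)‖ ≤ C + n * ε := by
  have hpt : ∀ k : ℕ, (x : ℂ) + Complex.I + (k : ℂ) * D = ((x + k * D : ℝ) : ℂ) + Complex.I := by
    intro k; push_cast; ring
  simp only [hpt]
  by_cases hbad : ∃ k : ℕ, |x + k * D| ≤ T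
  · obtain ⟨k₀, hk₀⟩ := hbad
    have hle : ∀ k ∈ Finset.range n,
        ‖F (((x + k * D : ℝ) : ℂ) + Complex.I)‖ ≤ (if k = k₀ then C else 0) + ε := by
      intro k _
      by_cases hk : k = k₀
      · simpa [hk] using (hC (x + k₀ * D)).trans (le_add_of_nonneg_right hε)
      · simp only [hk, if_false, zero_add]
        refine hT _ ?_
        by_contra! hkT
        have h1 := abs_le.1 hk₀
        have h2 := abs_le.1 hkT
        rcases Nat.lt_or_gt_of_ne hk with h | h
        · have h' : (k : ℝ) + 1 ≤ k₀ := by exact_mod_cast h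
          nlinarith
        · have h' : (k₀ : ℝ) + 1 ≤ k := by exact_mod_cast h
          nlinarith
    refine (norm_sum_le_of_le _ hle).trans ?_
    rw [Finset.sum_add_distrib, Finset.sum_ite_eq']
    simp only [Finset.sum_const, Finset.card_range, nsmul_eq_mul]
    gcongr
    split_ifs <;> simp [hC0]
  · push Not at hbad
    refine (norm_sum_le_of_le _ fun k _ => hT _ (hbad k)).trans ?_
    simp [hC0]

/-- Schwarz lemma on the disc of radius Im z - 1 about z, where F stays within 2C of F z. -/
theorem norm_sub_le_of_bounded {F : ℂ → ℂ} (hF : DifferentiableOn ℂ F {z | 0 < z.im}) {C : ℝ}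
    (hC : ∀ z : ℂ, 1 ≤ z.im → ‖F z‖ ≤ C) {z h : ℂ} (hz : ‖h‖ < z.im - 1) :
    ‖F (z + h) - F z‖ ≤ 2 * C / (z.im - 1) * ‖h‖ := by
  have him : ∀ w ∈ Metric.ball z (z.im - 1), 1 ≤ w.im := by
    intro w hw
    have h1 := (Complex.abs_im_le_norm (w - z)).trans_lt (mem_ball_iff_norm.1 hw)
    have h2 := (abs_lt.1 h1).1
    rw [Complex.sub_im] at h2
    linarith
  have hz1 : 1 ≤ z.im := by linarith [norm_nonneg h]
  have key := Complex.dist_le_div_mul_dist_of_mapsTo_ball (f := F) (c := z) (z := z + h)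
    (R₁ := z.im - 1) (R₂ := 2 * C) (hF.mono fun w hw => one_pos.trans_le (him w hw)) ?_ ?_
  · simpa [dist_eq_norm] using key
  · intro w hw
    rw [mem_closedBall_iff_norm]
    exact (norm_sub_le _ _).trans (by linarith [hC w (him w hw), hC z hz1])
  · simpa [mem_ball_iff_norm] using hz

/-- A bounded holomorphic function on a half plane which vanishes at infinity on the boundary line
tends to zero uniformly on the parallels to that line. -/
theorem exists_norm_le_of_vanishing_on_line {F : ℂ → ℂ}
    (hF : DifferentiableOn ℂ F {z | 0 < z.im}) {C : ℝ} (hC : ∀ z : ℂ, 1 ≤ z.im → ‖F z‖ ≤ C)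
    (hT : ∀ ε : ℝ, 0 < ε → ∃ T, ∀ x : ℝ, T < |x| → ‖F (x + Complex.I)‖ ≤ ε) {ε : ℝ} (hε : 0 < ε) :
    ∃ y : ℝ, 1 ≤ y ∧ ∀ x : ℝ, ‖F (x + y * Complex.I)‖ ≤ ε := by
  have hC0 : 0 ≤ C := (norm_nonneg _).trans (hC Complex.I (by simp))
  obtain ⟨T, hT⟩ := hT (ε / 3) (by positivity)
  -- The n translates sum to at most C + n ε/3 by Phragmén-Lindelöf, and this n makes C < n ε/3. At
  -- height 1 + r each translate differs from F z by at most ε/3, so n ‖F z‖ ≤ n ε.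
  obtain ⟨n, hn⟩ := exists_nat_gt (C / (ε / 3))
  have hn0 : (0 : ℝ) < n := lt_of_le_of_lt (by positivity) hn
  rw [div_lt_iff₀ (by positivity)] at hn
  obtain ⟨D, hD⟩ : ∃ D, D = 2 * |T| + 1 := ⟨_, rfl⟩
  have hD0 : 0 < D := by rw [hD]; positivity
  have hDT : 2 * T < D := by rw [hD]; linarith [le_abs_self T]
  obtain ⟨r, hr⟩ : ∃ r, r = n * D + 6 * C * (n * D) / ε + 1 := ⟨_, rfl⟩
  have hrn : n * D < r := by
    rw [hr]
    have : 0 ≤ 6 * C * (n * D) / ε := by positivity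
    linarith
  have hr0 : 0 < r := lt_trans (by positivity) hrn
  have hrC : 2 * C / r * (n * D) ≤ ε / 3 := by
    have h1 : 6 * C * (n * D) / ε ≤ r := by
      rw [hr]
      have : 0 ≤ n * D := by positivity
      linarith
    rw [div_le_iff₀ hε] at h1
    rw [div_mul_eq_mul_div, div_le_iff₀ hr0]
    linarith
  refine ⟨1 + r, by linarith, fun x => ?_⟩
  obtain ⟨z, hz⟩ : ∃ z : ℂ, z = x + ((1 + r : ℝ) : ℂ) * Complex.I := ⟨_, rfl⟩
  have hzim : z.im - 1 = r := by simp [hz]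
  rw [← hz]
  have hsum : ‖∑ k ∈ Finset.range n, F (z + (k : ℂ) * D)‖ ≤ C + n * (ε / 3) := by
    refine norm_le_of_norm_le_on_line (F := fun z => ∑ k ∈ Finset.range n, F (z + (k : ℂ) * D))
      (C := n * C) (A := C + n * (ε / 3)) ?_ ?_ ?_ (by linarith)
    · refine DifferentiableOn.fun_sum fun k _ => ?_
      refine hF.comp (f := fun z : ℂ => z + (k : ℂ) * D) (by fun_prop) fun w hw => ?_
      simpa using hw
    · intro w hw
      refine (norm_sum_le_of_le _ fun k _ => hC _ (by simpa using hw)).trans ?_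
      simp
    · exact norm_sum_translates_le hC0 (fun x => hC _ (by simp)) (by positivity) hT n hD0 hDT
  have hdiff : ‖∑ k ∈ Finset.range n, (F (z + (k : ℂ) * D) - F z)‖ ≤ n * (ε / 3) := by
    refine (norm_sum_le_of_le (n := fun _ => ε / 3) _ fun k hk => ?_).trans (by simp)
    have hkn : ‖(k : ℂ) * D‖ ≤ n * D := by
      have : (k : ℝ) ≤ n := by exact_mod_cast (Finset.mem_range.1 hk).le
      simp only [norm_mul, Complex.norm_natCast, Complex.norm_real, Real.norm_eq_abs,
        abs_of_pos hD0]
      gcongr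
    refine (norm_sub_le_of_bounded hF hC (by rw [hzim]; exact hkn.trans_lt hrn)).trans ?_
    rw [hzim]
    refine le_trans ?_ hrC
    gcongr
  have heq : (n : ℂ) * F z = ∑ k ∈ Finset.range n, F (z + (k : ℂ) * D)
      - ∑ k ∈ Finset.range n, (F (z + (k : ℂ) * D) - F z) := by
    simp [Finset.sum_sub_distrib]
  have hfin : n * ‖F z‖ ≤ n * ε := by
    have : n * ‖F z‖ = ‖(n : ℂ) * F z‖ := by simp
    rw [this, heq]
    refine (norm_sub_le _ _).trans ?_
    linarith
  exact le_of_mul_le_mul_left hfin hn0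

/-- The supremum of `‖F‖` on the horizontal line at height `y`. -/
noncomputable def lineSup (F : ℂ → ℂ) (y : ℝ) : ℝ :=
  ⨆ x : ℝ, ‖F (x + y * Complex.I)‖

/-! ### Log-convexity and growth of suprema on lines -/

section LineSup

variable {F : ℂ → ℂ}

theorem norm_le_lineSup {l C : ℝ} (hC : ∀ z : ℂ, z.im = l → ‖F z‖ ≤ C) (x : ℝ) :
    ‖F (x + l * Complex.I)‖ ≤ lineSup F l :=
  le_ciSup (f := fun x : ℝ => ‖F (x + l * Complex.I)‖)
    ⟨C, by rintro _ ⟨x, rfl⟩; exact hC _ (by simp)⟩ x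

theorem lineSup_nonneg (F : ℂ → ℂ) (y : ℝ) : 0 ≤ lineSup F y :=
  Real.iSup_nonneg fun _ => norm_nonneg _

theorem lineSup_le_rpow (hF : DifferentiableOn ℂ F {z | 0 < z.im})
    (hB : ∀ l u : ℝ, 0 < l → ∃ C, ∀ z : ℂ, l ≤ z.im → z.im ≤ u → ‖F z‖ ≤ C)
    {l y u : ℝ} (hl : 0 < l) (hly : l < y) (hyu : y < u) :
    lineSup F y ≤
      lineSup F l ^ (1 - (y - l) / (u - l)) * lineSup F u ^ ((y - l) / (u - l)) := by
  obtain ⟨C, hC⟩ := hB l u hl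
  refine ciSup_le fun x => ?_
  refine norm_le_interp_of_im hF hl hly hyu hC ?_ ?_ x
  · exact norm_le_lineSup fun z hz => hC z hz.ge (hz ▸ (hly.trans hyu).le)
  · exact norm_le_lineSup fun z hz => hC z (hz ▸ (hly.trans hyu).le) hz.le

/-- If the supremum vanished on one line, three lines with that line as an edge would make it vanish
at y₀. -/
theorem lineSup_pos (hF : DifferentiableOn ℂ F {z | 0 < z.im})
    (hB : ∀ l u : ℝ, 0 < l → ∃ C, ∀ z : ℂ, l ≤ z.im → z.im ≤ u → ‖F z‖ ≤ C)
    {y₀ : ℝ} (hy₀ : 0 < y₀) (h : 0 < lineSup F y₀) {y : ℝ} (hy : 0 < y) : 0 < lineSup F y := by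
  refine (lineSup_nonneg F y).lt_of_ne fun h0 => h.not_ge ?_
  rcases lt_trichotomy y y₀ with hlt | rfl | hlt
  · have h1 := lineSup_le_rpow hF hB hy hlt (lt_add_one y₀)
    have hne : 1 - (y₀ - y) / (y₀ + 1 - y) ≠ 0 := by
      rw [one_sub_div (by linarith)]
      exact (div_pos (by linarith) (by linarith)).ne'
    rwa [← h0, Real.zero_rpow hne, zero_mul] at h1
  · exact h0.symm.le
  · have h1 := lineSup_le_rpow hF hB (half_pos hy₀) (half_lt_self hy₀) hlt
    have hne : (y₀ - y₀ / 2) / (y - y₀ / 2) ≠ 0 :=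
      (div_pos (by linarith) (by linarith)).ne'
    rwa [← h0, Real.zero_rpow hne, mul_zero] at h1

theorem convexOn_log_lineSup (hF : DifferentiableOn ℂ F {z | 0 < z.im})
    (hB : ∀ l u : ℝ, 0 < l → ∃ C, ∀ z : ℂ, l ≤ z.im → z.im ≤ u → ‖F z‖ ≤ C)
    (hpos : ∀ y, 0 < y → 0 < lineSup F y) :
    ConvexOn ℝ (Ioi 0) fun y => Real.log (lineSup F y) := by
  refine LinearOrder.convexOn_of_lt (convex_Ioi 0) ?_
  intro x hx y hy hxy a b ha hb hab
  have hx : 0 < x := hx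
  have hy : 0 < y := hy
  have ha' : a = 1 - b := by linarith
  have hb1 : b < 1 := by linarith
  obtain ⟨w, hw⟩ : ∃ w, w = a • x + b • y := ⟨_, rfl⟩
  have hw' : w = x + b * (y - x) := by
    rw [hw, ha', smul_eq_mul, smul_eq_mul]; ring
  have hxw : x < w := by rw [hw']; nlinarith
  have hwy : w < y := by rw [hw']; nlinarith
  have ht : (w - x) / (y - x) = b := by
    rw [hw', add_sub_cancel_left, mul_div_cancel_right₀ _ (sub_pos.2 hxy).ne']
  have h1 := lineSup_le_rpow hF hB hx hxw hwy
  rw [ht, ← ha'] at h1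
  have h2 := Real.log_le_log (hpos w (hx.trans hxw)) h1
  rw [Real.log_mul (Real.rpow_pos_of_pos (hpos x hx) _).ne'
    (Real.rpow_pos_of_pos (hpos y hy) _).ne', Real.log_rpow (hpos x hx),
    Real.log_rpow (hpos y hy)] at h2
  rw [← hw]
  simpa only [smul_eq_mul] using h2

theorem exists_support_of_convexOn {g : ℝ → ℝ} (hg : ConvexOn ℝ (Ioi 0) g) :
    ∃ s : ℝ → ℝ, ∀ x, 0 < x → ∀ y, 0 < y → g x + s x * (y - x) ≤ g y := by
  refine ⟨fun x => derivWithin g (Ioi x) x, fun x hx y hy => ?_⟩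
  have hxi : x ∈ interior (Ioi (0 : ℝ)) := by rwa [interior_Ioi]
  rcases lt_trichotomy x y with h | rfl | h
  · have h1 := hg.rightDeriv_le_slope_of_mem_interior hxi hy h
    rw [slope_def_field, le_div_iff₀ (sub_pos.2 h)] at h1
    linarith
  · simp
  · have h1 := (hg.slope_le_leftDeriv_of_mem_interior hy hxi h).trans
      (hg.leftDeriv_le_rightDeriv_of_mem_interior hxi)
    rw [slope_def_field, div_le_iff₀ (sub_pos.2 h)] at h1
    linarith

/-- If a function on the half plane vanishes at infinity on the line at height `1`, then the
logarithm of its suprema on horizontal lines is not asymptotic to an affine function. -/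
theorem exists_log_lineSup_lt (hF : DifferentiableOn ℂ F {z | 0 < z.im})
    (hB : ∀ l u : ℝ, 0 < l → ∃ C, ∀ z : ℂ, l ≤ z.im → z.im ≤ u → ‖F z‖ ≤ C)
    (hpos : ∀ y, 0 < y → 0 < lineSup F y)
    (hT : ∀ ε : ℝ, 0 < ε → ∃ T, ∀ x : ℝ, T < |x| → ‖F (x + Complex.I)‖ ≤ ε) {a C : ℝ}
    (hC : ∀ y, 1 ≤ y → Real.log (lineSup F y) ≤ a * y + C) (B : ℝ) :
    ∃ y, 1 ≤ y ∧ Real.log (lineSup F y) < a * y + B := by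
  -- The factor has modulus exp(-a Im z), so the affine bound on the logarithm becomes boundedness
  -- of E.
  obtain ⟨E, hE⟩ : ∃ E : ℂ → ℂ, E = fun z => F z * Complex.exp (a * Complex.I * z) := ⟨_, rfl⟩
  have hEd : DifferentiableOn ℂ E {z | 0 < z.im} := hE ▸ hF.mul (by fun_prop)
  have hEnorm : ∀ z, ‖E z‖ = ‖F z‖ * Real.exp (-(a * z.im)) := by
    intro z
    simp [hE, Complex.norm_exp]
  have hle : ∀ z : ℂ, 0 < z.im → ‖F z‖ ≤ lineSup F z.im := by
    intro z hz
    obtain ⟨C, hC⟩ := hB z.im z.im hz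
    have := norm_le_lineSup (F := F) (l := z.im) (fun w hw => hC w hw.ge hw.le) z.re
    rwa [Complex.re_add_im] at this
  have hEC : ∀ z : ℂ, 1 ≤ z.im → ‖E z‖ ≤ Real.exp C := by
    intro z hz
    have hz0 : 0 < z.im := by linarith
    have h1 := (Real.log_le_iff_le_exp (hpos _ hz0)).1 (hC _ hz)
    rw [hEnorm, Real.exp_neg, ← div_eq_mul_inv, div_le_iff₀ (Real.exp_pos _), ← Real.exp_add,
      add_comm]
    exact (hle z hz0).trans h1
  have hET : ∀ ε : ℝ, 0 < ε → ∃ T, ∀ x : ℝ, T < |x| → ‖E (x + Complex.I)‖ ≤ ε := by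
    intro ε hε
    obtain ⟨T, hT⟩ := hT (ε * Real.exp a) (by positivity)
    refine ⟨T, fun x hx => ?_⟩
    have him : ((x : ℂ) + Complex.I).im = 1 := by simp
    rw [hEnorm, him, mul_one, Real.exp_neg, ← div_eq_mul_inv, div_le_iff₀ (Real.exp_pos _)]
    exact hT x hx
  obtain ⟨y, hy, hyB⟩ := exists_norm_le_of_vanishing_on_line hEd hEC hET (Real.exp_pos (B - 1))
  refine ⟨y, hy, ?_⟩
  have hy0 : 0 < y := by linarith
  have h1 : lineSup F y ≤ Real.exp (a * y + (B - 1)) := by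
    refine ciSup_le fun x => ?_
    have h2 := hyB x
    rw [hEnorm] at h2
    have him : ((x : ℂ) + y * Complex.I).im = y := by simp
    rw [him, Real.exp_neg, ← div_eq_mul_inv, div_le_iff₀ (Real.exp_pos _)] at h2
    rwa [Real.exp_add, mul_comm (Real.exp _)]
  have h3 := (Real.log_le_iff_le_exp (hpos y hy0)).2 h1
  linarith

end LineSup

/-! ### Weights and compact sets -/

theorem LocallyBddAbove.exists_le {φ : ℝ → ℝ} (hφ : LocallyBddAbove φ) {l : ℝ} (u : ℝ)
    (hl : 0 < l) : ∃ B, ∀ t, l ≤ t → t ≤ u → φ t ≤ B := by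
  have h0 : 0 < 1 / l := by positivity
  obtain ⟨B, hB⟩ := hφ (1 / l + |u| + 1) (by linarith [abs_nonneg u])
  refine ⟨B, fun t ht htu => hB ⟨t, ⟨?_, ?_⟩, rfl⟩⟩
  · refine le_trans ?_ ht
    rw [div_le_iff₀ (by positivity)]
    have : l * (1 / l) = 1 := by field_simp
    nlinarith [mul_nonneg hl.le (abs_nonneg u)]
  · linarith [le_abs_self u]

theorem isCompact_box {l : ℝ} (hl : 0 < l) (u T : ℝ) :
    IsCompact {z : ℍ | z.im ∈ Icc l u ∧ |z.re| ≤ T} := by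
  have hc : IsCompact (Icc (-T) T ×ℂ Icc l u) := isCompact_Icc.reProdIm isCompact_Icc
  have hco : ContinuousOn (fun z : ℂ => ofComplex z) (Icc (-T) T ×ℂ Icc l u) := fun z hz =>
    (contMDiffAt_ofComplex (n := 0) (hl.trans_le hz.2.1)).continuousAt.continuousWithinAt
  refine (hc.image_of_continuousOn hco).of_isClosed_subset ?_ ?_
  · exact (isClosed_Icc.preimage UpperHalfPlane.continuous_im).inter
      (isClosed_le (continuous_abs.comp UpperHalfPlane.continuous_re) continuous_const)
  · rintro z ⟨hz1, hz2⟩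
    exact ⟨z, ⟨abs_le.1 hz2, hz1⟩, ofComplex_apply z⟩

theorem expWeight_mul_le {φ : ℝ → ℝ} {z : ℍ} {r C : ℝ} :
    (expWeight φ z : ℝ) * r ≤ C ↔ r ≤ C * Real.exp (φ z.im) := by
  simp only [expWeight, Real.exp_neg]
  rw [inv_mul_le_iff₀ (Real.exp_pos _), mul_comm]

theorem expWeight_mul_lt {φ : ℝ → ℝ} {z : ℍ} {r C : ℝ} :
    (expWeight φ z : ℝ) * r < C ↔ r < C * Real.exp (φ z.im) := by
  simp only [expWeight, Real.exp_neg]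
  rw [inv_mul_lt_iff₀ (Real.exp_pos _), mul_comm]

theorem expWeight_le_biconj {φ : ℝ → ℝ} (hφ : MemPhi φ) (f : ℍ → ℂ) (z : ℍ) :
    (expWeight φ z : ℝ) * ‖f z‖ ≤ (expWeight (biconj φ) z : ℝ) * ‖f z‖ := by
  refine mul_le_mul_of_nonneg_right ?_ (norm_nonneg _)
  exact Real.exp_le_exp.2 (neg_le_neg (biconj_le hφ z.im_pos))

theorem H0_biconj_le {φ : ℝ → ℝ} (hφ : MemPhi φ) :
    H0 (expWeight (biconj φ)) ≤ H0 (expWeight φ) := by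
  rintro f ⟨⟨hd, A, hA⟩, h0⟩
  refine ⟨⟨hd, A, ?_⟩, fun ε hε => ?_⟩
  · rintro _ ⟨z, rfl⟩
    exact (expWeight_le_biconj hφ f z).trans (hA ⟨z, rfl⟩)
  · obtain ⟨K, hK, h⟩ := h0 ε hε
    exact ⟨K, hK, fun z hz => (expWeight_le_biconj hφ f z).trans_lt (h z hz)⟩

/-! ### Membership and norm for the biconjugate weight -/

section Vanishing

variable {φ : ℝ → ℝ} {f : ℍ → ℂ}

theorem exists_norm_lt_of_mem_H0 (hφ_loc : LocallyBddAbove φ) (hf : f ∈ H0 (expWeight φ))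
    {l : ℝ} (u : ℝ) (hl : 0 < l) {ε : ℝ} (hε : 0 < ε) :
    ∃ T, ∀ z : ℍ, l ≤ z.im → z.im ≤ u → T < |z.re| → ‖f z‖ < ε := by
  obtain ⟨B, hB⟩ := hφ_loc.exists_le u hl
  obtain ⟨K, hK, h⟩ := hf.2 (ε * Real.exp (-B)) (by positivity)
  obtain ⟨T, hT⟩ := (hK.image (continuous_abs.comp UpperHalfPlane.continuous_re)).bddAbove
  refine ⟨T, fun z hzl hzu hzT => ?_⟩
  have h1 := expWeight_mul_lt.1 (h z fun hz => hzT.not_ge (hT ⟨z, hz, rfl⟩))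
  refine h1.trans_le ?_
  rw [mul_assoc, ← Real.exp_add]
  exact mul_le_of_le_one_right hε.le (Real.exp_le_one_iff.2 (by linarith [hB z.im hzl hzu]))

theorem exists_im_bounds_of_mem_H0 (hf : f ∈ H0 (expWeight φ)) (N : ℝ) :
    ∃ l u : ℝ, 0 < l ∧ ∀ z : ℍ, z.im < l ∨ u < z.im → ‖f z‖ ≤ Real.exp (φ z.im - N) := by
  obtain ⟨K, hK, h⟩ := hf.2 (Real.exp (-N)) (Real.exp_pos _)
  have hKi := hK.image UpperHalfPlane.continuous_im
  obtain ⟨u, hu⟩ := hKi.bddAbove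
  obtain ⟨l, hl, hlK⟩ : ∃ l, 0 < l ∧ ∀ z ∈ K, l ≤ z.im := by
    rcases K.eq_empty_or_nonempty with rfl | hne
    · exact ⟨1, one_pos, by simp⟩
    · obtain ⟨z₀, -, hz₀⟩ := hK.exists_isMinOn hne UpperHalfPlane.continuous_im.continuousOn
      exact ⟨z₀.im, z₀.im_pos, fun z hz => hz₀ hz⟩
  refine ⟨l, u, hl, fun z hz => ?_⟩
  have hzK : z ∉ K := by
    intro hzK
    rcases hz with hz | hz
    · exact hz.not_ge (hlK z hzK)
    · exact hz.not_ge (hu ⟨z, hzK, rfl⟩)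
  refine (expWeight_mul_lt.1 (h z hzK)).le.trans_eq ?_
  rw [← Real.exp_add]
  congr 1
  ring

/-- Here g is the logarithm of `lineSup`. Being the least majorant of log |f| that depends on height
alone, it inherits every bound by φ. -/
theorem exists_log_convex_majorant (hφ_loc : LocallyBddAbove φ) (hf : f ∈ H0 (expWeight φ))
    (hf0 : f ≠ 0) :
    ∃ g s : ℝ → ℝ, (∀ x, 0 < x → ∀ y, 0 < y → g x + s x * (y - x) ≤ g y) ∧
      (∀ z : ℍ, ‖f z‖ ≤ Real.exp (g z.im)) ∧
      (∀ y b, 0 < y → (∀ z : ℍ, z.im = y → ‖f z‖ ≤ Real.exp b) → g y ≤ b) ∧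
      ∀ a C : ℝ, (∀ y, 1 ≤ y → g y ≤ a * y + C) → ∀ B, ∃ y, 1 ≤ y ∧ g y < a * y + B := by
  obtain ⟨⟨hd, A, hA⟩, -⟩ := id hf
  obtain ⟨F, hFdef⟩ : ∃ F : ℂ → ℂ, F = f ∘ ofComplex := ⟨_, rfl⟩
  have hFf : ∀ z : ℂ, ∀ hz : 0 < z.im, F z = f ⟨z, hz⟩ := by
    intro z hz
    rw [hFdef, Function.comp_apply, ofComplex_apply_of_im_pos hz]
  have hFz : ∀ z : ℍ, F z = f z := fun z => hFf z z.im_pos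
  have hF : DifferentiableOn ℂ F {z | 0 < z.im} := hFdef ▸ mdifferentiable_iff.1 hd
  have hA0 : 0 ≤ A := by
    have := hA ⟨UpperHalfPlane.I, rfl⟩
    exact (mul_nonneg (le_of_lt (expWeight φ UpperHalfPlane.I).2) (norm_nonneg _)).trans this
  have hB : ∀ l u : ℝ, 0 < l → ∃ C, ∀ z : ℂ, l ≤ z.im → z.im ≤ u → ‖F z‖ ≤ C := by
    intro l u hl
    obtain ⟨B, hB⟩ := hφ_loc.exists_le u hl
    refine ⟨A * Real.exp B, fun z hzl hzu => ?_⟩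
    rw [hFf z (hl.trans_le hzl)]
    refine (expWeight_mul_le.1 (hA ⟨⟨z, hl.trans_le hzl⟩, rfl⟩)).trans ?_
    exact mul_le_mul_of_nonneg_left (Real.exp_le_exp.2 (hB _ hzl hzu)) hA0
  have hle : ∀ z : ℍ, ‖f z‖ ≤ lineSup F z.im := by
    intro z
    obtain ⟨C, hC⟩ := hB z.im z.im z.im_pos
    have := norm_le_lineSup (F := F) (l := z.im) (fun w hw => hC w hw.ge hw.le) z.re
    have hz : ((z.re : ℝ) : ℂ) + (z.im : ℝ) * Complex.I = z := Complex.re_add_im (z : ℂ)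
    rwa [hz, hFz] at this
  obtain ⟨z₀, hz₀⟩ : ∃ z₀, f z₀ ≠ 0 := Function.ne_iff.1 hf0
  have hpos : ∀ y, 0 < y → 0 < lineSup F y := fun y hy =>
    lineSup_pos hF hB z₀.im_pos ((norm_pos_iff.2 hz₀).trans_le (hle z₀)) hy
  obtain ⟨s, hs⟩ := exists_support_of_convexOn (convexOn_log_lineSup hF hB hpos)
  refine ⟨fun y => Real.log (lineSup F y), s, hs, fun z => ?_, fun y b hy hb => ?_,
    fun a C hC B => exists_log_lineSup_lt hF hB hpos ?_ hC B⟩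
  · rw [Real.exp_log (hpos _ z.im_pos)]
    exact hle z
  · rw [Real.log_le_iff_le_exp (hpos y hy)]
    refine ciSup_le fun x => ?_
    have him : ((x : ℂ) + y * Complex.I).im = y := by simp
    rw [hFf _ (him.symm ▸ hy)]
    exact hb _ him
  · intro ε hε
    obtain ⟨T, hT⟩ := exists_norm_lt_of_mem_H0 hφ_loc hf 1 one_pos hε
    refine ⟨T, fun x hx => ?_⟩
    have him : ((x : ℂ) + Complex.I).im = 1 := by simp
    have hre : ((x : ℂ) + Complex.I).re = x := by simp
    have h0 : 0 < ((x : ℂ) + Complex.I).im := him.symm ▸ one_pos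
    rw [hFf _ h0]
    exact (hT ⟨_, h0⟩ him.ge him.le (hx.trans_eq (congrArg _ hre.symm))).le

theorem norm_le_mul_exp_biconj (hφ_loc : LocallyBddAbove φ) (hf : f ∈ H0 (expWeight φ))
    {C : ℝ} (hC : ∀ z, (expWeight φ z : ℝ) * ‖f z‖ ≤ C) (z : ℍ) :
    (expWeight (biconj φ) z : ℝ) * ‖f z‖ ≤ C := by
  rw [expWeight_mul_le]
  rcases eq_or_ne f 0 with rfl | hf0
  · have h1 := hC z
    simp only [Pi.zero_apply, norm_zero, mul_zero] at h1 ⊢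
    positivity
  obtain ⟨z₀, hz₀⟩ : ∃ z₀, f z₀ ≠ 0 := Function.ne_iff.1 hf0
  have hCpos : 0 < C := (mul_pos (expWeight φ z₀).2 (norm_pos_iff.2 hz₀)).trans_le (hC z₀)
  obtain ⟨g, s, hs, hfg, hgb, -⟩ := exists_log_convex_majorant hφ_loc hf hf0
  have key := le_biconj_of_support (g := fun t => g t - Real.log C) (s := s) (φ := φ)
    (fun x hx y hy => by linarith [hs x hx y hy]) (fun t ht => ?_) z.im_pos
  · refine (hfg z).trans ?_
    rw [← Real.exp_log hCpos, ← Real.exp_add]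
    exact Real.exp_le_exp.2 (by linarith)
  · have := hgb t (Real.log C + φ t) ht fun w hw => by
      rw [Real.exp_add, Real.exp_log hCpos, ← hw]
      exact expWeight_mul_le.1 (hC w)
    linarith

theorem exists_im_bounds_biconj (hφ_loc : LocallyBddAbove φ) (hφ : MemPhi φ)
    (hφ_zero : Tendsto φ (𝓝[>] 0) atTop) (hf : f ∈ H0 (expWeight φ)) {ε : ℝ} (hε : 0 < ε) :
    ∃ l u : ℝ, 0 < l ∧
      ∀ z : ℍ, z.im < l ∨ u < z.im → (expWeight (biconj φ) z : ℝ) * ‖f z‖ < ε := by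
  rcases eq_or_ne f 0 with rfl | hf0
  · exact ⟨1, 1, one_pos, fun z _ => by simpa using hε⟩
  obtain ⟨g, s, hs, hfg, hgb, hgrow⟩ := exists_log_convex_majorant hφ_loc hf hf0
  have hN : ∀ N, ∃ l u : ℝ, 0 < l ∧ ∀ y, 0 < y → y < l ∨ u < y → N ≤ φ y - g y := by
    intro N
    obtain ⟨l, u, hl, h⟩ := exists_im_bounds_of_mem_H0 hf N
    refine ⟨l, u, hl, fun y hy hyl => ?_⟩
    have := hgb y (φ y - N) hy fun z hz => by
      subst hz
      exact h z hyl
    linarith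
  have h0 : Tendsto (fun y => φ y - g y) (𝓝[>] 0) atTop := by
    refine tendsto_atTop.2 fun N => ?_
    obtain ⟨l, u, hl, h⟩ := hN N
    filter_upwards [Ioo_mem_nhdsGT hl] with y hy using h y hy.1 (Or.inl hy.2)
  have h1 : Tendsto (fun y => φ y - g y) atTop atTop := by
    refine tendsto_atTop.2 fun N => ?_
    obtain ⟨l, u, hl, h⟩ := hN N
    filter_upwards [eventually_gt_atTop 0, eventually_gt_atTop u] with y hy hyu
      using h y hy (Or.inr hyu)
  have h0' := (tendsto_biconj_sub_zero hφ hφ_zero hs h0).eventually_gt_atTop (-Real.log ε)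
  have h1' := (tendsto_biconj_sub_atTop hφ hs hgrow h1).eventually_gt_atTop (-Real.log ε)
  obtain ⟨l, hl, hl'⟩ := mem_nhdsGT_iff_exists_Ioo_subset.1 h0'
  obtain ⟨u, hu⟩ := eventually_atTop.1 h1'
  refine ⟨l, u, hl, fun z hz => ?_⟩
  have hz' : -Real.log ε < biconj φ z.im - g z.im := by
    rcases hz with hz | hz
    · exact hl' ⟨z.im_pos, hz⟩
    · exact hu _ hz.le
  rw [expWeight_mul_lt]
  refine (hfg z).trans_lt ?_
  rw [← Real.exp_log hε, ← Real.exp_add]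
  exact Real.exp_lt_exp.2 (by linarith)

theorem mem_H0_biconj (hφ_loc : LocallyBddAbove φ) (hφ : MemPhi φ)
    (hφ_zero : Tendsto φ (𝓝[>] 0) atTop) (hf : f ∈ H0 (expWeight φ)) :
    f ∈ H0 (expWeight (biconj φ)) := by
  obtain ⟨⟨hd, A, hA⟩, -⟩ := id hf
  refine ⟨⟨hd, A, ?_⟩, fun ε hε => ?_⟩
  · rintro _ ⟨z, rfl⟩
    exact norm_le_mul_exp_biconj hφ_loc hf (fun z => hA ⟨z, rfl⟩) z
  obtain ⟨l, u, hl, hlu⟩ := exists_im_bounds_biconj hφ_loc hφ hφ_zero hf hε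
  obtain ⟨a, b, hab⟩ := hφ.exists_affine_le
  -- In the strip φ** ≥ b - |a| u, so the new weight is bounded there and smallness of f for large
  -- |Re z| suffices.
  obtain ⟨T, hT⟩ := exists_norm_lt_of_mem_H0 hφ_loc hf u hl
    (ε := ε * Real.exp (b - |a| * u)) (by positivity)
  refine ⟨_, isCompact_box hl u T, fun z hz => ?_⟩
  by_cases hzl : z.im < l ∨ u < z.im
  · exact hlu z hzl
  · push Not at hzl
    have hzT : T < |z.re| := by
      by_contra! h
      exact hz ⟨hzl, h⟩
    rw [expWeight_mul_lt]
    refine (hT z hzl.1 hzl.2 hzT).trans_le ?_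
    refine mul_le_mul_of_nonneg_left (Real.exp_le_exp.2 ?_) hε.le
    have h1 := le_biconj hab z.im_pos
    have h2 : -(|a| * u) ≤ a * z.im := by
      have := mul_le_mul_of_nonneg_left hzl.2 (abs_nonneg a)
      have := mul_le_mul_of_nonneg_right (neg_abs_le a) z.im_pos.le
      linarith
    linarith

end Vanishing

end WeightedHalfPlane

theorem theorem6p2 (φ : ℝ → ℝ)
    (hφ_loc : WeightedHalfPlane.LocallyBddAbove φ)
    (hφ : WeightedHalfPlane.MemPhi φ)
    (hφ_zero : Tendsto φ (𝓝[>] 0) atTop) :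
    WeightedHalfPlane.H0 (WeightedHalfPlane.expWeight φ) =
        WeightedHalfPlane.H0 (WeightedHalfPlane.expWeight (WeightedHalfPlane.biconj φ)) ∧
      ∀ f ∈ WeightedHalfPlane.H0 (WeightedHalfPlane.expWeight φ),
        WeightedHalfPlane.weightedNorm (WeightedHalfPlane.expWeight φ) f =
          WeightedHalfPlane.weightedNorm
            (WeightedHalfPlane.expWeight (WeightedHalfPlane.biconj φ)) f := by
  refine ⟨le_antisymm
    (fun f hf => WeightedHalfPlane.mem_H0_biconj hφ_loc hφ hφ_zero hf)
    (WeightedHalfPlane.H0_biconj_le hφ), fun f hf => le_antisymm ?_ ?_⟩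
  · exact ciSup_mono (WeightedHalfPlane.mem_H0_biconj hφ_loc hφ hφ_zero hf).1.2
      (WeightedHalfPlane.expWeight_le_biconj hφ f)
  · exact ciSup_le
      (WeightedHalfPlane.norm_le_mul_exp_biconj hφ_loc hf fun z => le_ciSup hf.1.2 z)
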